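/- Let $d\ge 2$ and let $|\cdot|$ be the sup-norm on $\mathbb R^d$, $\mathcal B=\{x\in\mathbb R^d: |x|\le 1\}$. For $\tau=(\tau_1,\dots,\tau_d)\in\mathbb R^d$ with $\tau_1+\dots+\tau_d=0$ put $D_\tau=\mathrm{diag}(e^{\tau_1},\dots,e^{\tau_d})$ and $\mathcal B_\tau=D_\tau\mathcal B$. For a full-rank lattice $\Lambda\subset\mathbb R^d$ of covolume $1$ let $\Lambda^*=\{y\in\mathbb R^d:\langle y,x\rangle\in\mathbb Z\text{ for each }x\in\Lambda\}$ be the dual lattice, let $\lambda_k(\mathcal B_\tau,\Lambda)$, $1\le k\le d$, be the $k$-th successive minimum, i.e. the infimum of the positive $\lambda$ such that $\lambda\mathcal B_\tau$ contains at least $k$ linearly independent vectors of $\Lambda$, and put $$L_k(\tau,\Lambda)=\log\lambda_k(\mathcal B_\tau,\Lambda),\qquad S_k(\tau,\Lambda)=\sum_{1\le j\le k}L_j(\tau,\Lambda).$$ Then the following holds. (i) There is a constant $C$ depending only on $d$ such that for every full-rank lattice $\Lambda\subset\mathbb R^d$ of covolume $1$, every $\tau\in\mathbb R^d$ with $\tau_1+\dots+\tau_d=0$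 and every $k=1,\dots,d-1$, $$\bigl|S_k(\tau,\Lambda)-S_{d-k}(-\tau,\Lambda^*)\bigr|\le C,$$ that is, $S_k(\tau,\Lambda)=S_{d-k}(-\tau,\Lambda^*)+O(1)$. (ii) For every such $\Lambda$ and $\tau$, $$S_1(\tau,\Lambda)\le\dots\le\frac{S_k(\tau,\Lambda)}{k}\le\dots\le\frac{S_{d-1}(\tau,\Lambda)}{d-1},$$ that is, $\frac{S_k(\tau,\Lambda)}{k}\le\frac{S_{k+1}(\tau,\Lambda)}{k+1}$ for $k=1,\dots,d-2$. (iii) For every such $\Lambda$ and $\tau$, $$\frac{S_1(\tau,\Lambda)}{d-1}\ge\dots\ge\frac{S_k(\tau,\Lambda)}{d-k}\ge\dots\ge S_{d-1}(\tau,\Lambda),$$ that is, $\frac{S_k(\tau,\Lambda)}{d-k}\ge\frac{S_{k+1}(\tau,\Lambda)}{d-k-1}$ for $k=1,\dots,d-2$. -/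

import Mathlib

open scoped Pointwise

noncomputable section

namespace MultParamGeom

/-- The box `D_τ B`, where `D_τ = diag(e^{τ₁}, …, e^{τ_d})` and `B = {x : |x| ≤ 1}` is the unit
ball of the sup-norm (which is the norm of `Fin d → ℝ`). -/
def box {d : ℕ} (τ : Fin d → ℝ) : Set (Fin d → ℝ) :=
  (Matrix.diagonal fun i => Real.exp (τ i)).mulVec '' Metric.closedBall (0 : Fin d → ℝ) 1

/-- The `k`-th successive minimum of the set `K` with respect to `Λ`: the infimum of the positive
`r` such that `r K` contains at least `k` linearly independent vectors of `Λ`. -/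
def successiveMinimum {d : ℕ} (K : Set (Fin d → ℝ)) (Λ : Submodule ℤ (Fin d → ℝ)) (k : ℕ) : ℝ :=
  sInf {r : ℝ | 0 < r ∧ ∃ v : Fin k → (Fin d → ℝ),
    LinearIndependent ℝ v ∧ ∀ i, v i ∈ Λ ∧ v i ∈ r • K}

/-- `L_k(τ, Λ) = log λ_k(D_τ B, Λ)`. -/
def L {d : ℕ} (k : ℕ) (τ : Fin d → ℝ) (Λ : Submodule ℤ (Fin d → ℝ)) : ℝ :=
  Real.log (successiveMinimum (box τ) Λ k)

/-- `S_k(τ, Λ) = ∑_{1 ≤ j ≤ k} L_j(τ, Λ)`. -/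
def S {d : ℕ} (k : ℕ) (τ : Fin d → ℝ) (Λ : Submodule ℤ (Fin d → ℝ)) : ℝ :=
  ∑ j ∈ Finset.Icc 1 k, L j τ Λ

/-- The dual lattice `Λ* = {y : ⟨y, x⟩ ∈ ℤ for each x ∈ Λ}`. -/
def dualLattice {d : ℕ} (Λ : Submodule ℤ (Fin d → ℝ)) : Submodule ℤ (Fin d → ℝ) :=
  LinearMap.BilinForm.dualSubmodule (R := ℤ) (dotProductBilin ℝ ℝ) Λ

end MultParamGeom

end

namespace MultParamGeom

open MeasureTheory Module

/-! Two inputs carry everything. The first is the upper half of Minkowski's second theorem with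
sharp constant (`prod_mul_measure_ball_le_covolume`), which gives `S d τ Λ ≤ 0` with no error term.
The second is integrality: among `j` vectors of `Λ` and `k` of the dual with `j + k > d`, both
independent, some pair has nonzero integral product, so `λ_j λ*_k ≥ 1/d`.

(ii) is monotonicity of `L`. (iii) is `S_k + (d - k) L_{k+1} ≤ S_d ≤ 0`, so it needs the sharp
constant.

For (i), pair `L_{i+1}` with `L*_{d-i}`. Each pair sum is at least `-log d`, and all of them add up
to `S_d + S*_d ≤ 0`, so every partial sum is `O(1)`. The lower half of Minkowski's theorem is never
needed. -/

/-- A projection along a subspace `V`, with the determinants of the corresponding dilations. -/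
lemma exists_projection_det {E : Type*} [AddCommGroup E] [Module ℝ E] [FiniteDimensional ℝ E]
    (V : Submodule ℝ E) :
    ∃ P : E →ₗ[ℝ] E, (∀ x, x - P x ∈ V) ∧ (∀ x ∈ V, P x = 0) ∧ (∀ x, P (P x) = P x) ∧
      ∀ t : ℝ, LinearMap.det (LinearMap.id + (t - 1) • P) = t ^ (finrank ℝ E - finrank ℝ V) := by
  obtain ⟨W, hW⟩ := V.exists_isCompl
  set e := V.prodEquivOfIsCompl W hW with he
  have hdim : finrank ℝ E - finrank ℝ V = finrank ℝ W := by
    have := Submodule.finrank_add_eq_of_isCompl hW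
    omega
  refine ⟨(e : V × W →ₗ[ℝ] E) ∘ₗ (LinearMap.prodMap 0 LinearMap.id) ∘ₗ (e.symm : E →ₗ[ℝ] V × W),
    fun x => ?_, fun x hx => ?_, fun x => ?_, fun t => ?_⟩
  · obtain ⟨⟨v, w⟩, rfl⟩ := e.surjective x
    simp [he]
  · have : x = e (⟨x, hx⟩, 0) := by simp [he]
    rw [this]
    simp
  · simp
  · have : LinearMap.id + (t - 1) • ((e : V × W →ₗ[ℝ] E) ∘ₗ
        (LinearMap.prodMap 0 LinearMap.id) ∘ₗ (e.symm : E →ₗ[ℝ] V × W)) =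
        (e : V × W →ₗ[ℝ] E) ∘ₗ (LinearMap.prodMap LinearMap.id (t • LinearMap.id)) ∘ₗ
          (e.symm : E →ₗ[ℝ] V × W) := by
      ext x
      obtain ⟨⟨v, w⟩, rfl⟩ := e.surjective x
      simp [he]
      module
    rw [this, LinearMap.det_conj, LinearMap.det_prodMap, hdim]
    simp

/-! ### Minkowski's second theorem -/

section

variable {E : Type*} [NormedAddCommGroup E] [NormedSpace ℝ E] [FiniteDimensional ℝ E]
  [MeasurableSpace E] [BorelSpace E]

/-- If all points of `Γ` with gauge less than `b` lie in `V`, then a set in the ball of radius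
`a / 2` which has disjoint `Γ`-translates can be stretched transversally to `V` to a set in the ball
of radius `b / 2` with the same property. -/
lemma exists_stretched_packing (μ : Measure E) [μ.IsAddHaarMeasure] (p : Seminorm ℝ E)
    (hp : Continuous p) (Γ : Submodule ℤ E) (V : Submodule ℝ E) {a b : ℝ} (ha : 0 < a)
    (hab : a ≤ b) (hV : ∀ x ∈ Γ, p x < b → x ∈ V) {B : Set E} (hB : MeasurableSet B)
    (hBa : ∀ x ∈ B, p x < a / 2) (hBΓ : ∀ x ∈ B, ∀ y ∈ B, x - y ∈ Γ → x = y) :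
    ∃ B' : Set E, MeasurableSet B' ∧ (∀ x ∈ B', p x < b / 2) ∧
      (∀ x ∈ B', ∀ y ∈ B', x - y ∈ Γ → x = y) ∧
      μ B' = ENNReal.ofReal ((b / a) ^ (finrank ℝ E - finrank ℝ V)) * μ B := by
  obtain ⟨P, hP1, hP2, hP3, hdet⟩ := exists_projection_det V
  have hPc : Continuous P := P.continuous_of_finiteDimensional
  set t : ℝ := b / a with ht
  have ht1 : 1 ≤ t := by rw [ht, le_div_iff₀ ha]; linarith
  have hta : t * a = b := by rw [ht]; field_simp
  set T : E →ₗ[ℝ] E := LinearMap.id + (t - 1) • P with hT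
  have hTx (x) : T x = x + (t - 1) • P x := by simp [hT]
  have hTdet : LinearMap.det T ≠ 0 := by
    rw [hT, hdet]; positivity
  have hTinj : Function.Injective T := (T.equivOfDetNeZero hTdet).injective
  have hTc : Continuous T := T.continuous_of_finiteDimensional
  -- Each fibre of `P` meeting `B` needs a centre of gauge below `a / 2`. Centres `P x + v n` from a
  -- dense sequence leave countably many pieces, so measurability survives.
  let v : ℕ → V := TopologicalSpace.denseSeq V
  have hPv (n : ℕ) : P (v n) = 0 := hP2 _ (v n).2
  let U : ℕ → Set E := fun n => {x | p (P x + v n) < a / 2}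
  have hUo (n : ℕ) : IsOpen (U n) :=
    isOpen_lt (hp.comp (hPc.add continuous_const)) continuous_const
  let D : ℕ → Set E := disjointed U
  have hDm (n : ℕ) : MeasurableSet (D n) := MeasurableSet.disjointed (fun n => (hUo n).measurableSet) n
  -- The pieces are unions of whole fibres of `P`, so points of one fibre are moved by the same map.
  have hDP (n : ℕ) {x y : E} (h : P x = P y) (hx : x ∈ D n) : y ∈ D n := by
    simp only [D, disjointed_eq_inter_compl, U, Set.mem_inter_iff, Set.mem_iInter,
      Set.mem_compl_iff, Set.mem_ofPred_eq] at hx ⊢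
    rwa [← h]
  have hcover : B ⊆ ⋃ n, D n := by
    intro x hx
    rw [iUnion_disjointed]
    have hopen : IsOpen {w : V | p (P x + w) < a / 2} :=
      isOpen_lt (hp.comp (continuous_const.add continuous_subtype_val)) continuous_const
    obtain ⟨n, hn⟩ := (TopologicalSpace.denseRange_denseSeq V).exists_mem_open hopen
      ⟨⟨x - P x, hP1 x⟩, by simpa using hBa x hx⟩
    exact Set.mem_iUnion.2 ⟨n, hn⟩
  let f : ℕ → E → E := fun n x => T x + (t - 1) • (v n : E)
  have hPf (n : ℕ) (x : E) : P (f n x) = t • P x := by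
    simp only [f, hTx, map_add, map_smul, hP3, hPv]
    module
  have hfc (n : ℕ) : Continuous (f n) := hTc.add continuous_const
  have hfinj (n : ℕ) : Function.Injective (f n) := fun x y h => hTinj (add_right_cancel h)
  have hfp (n : ℕ) {x : E} (hx : x ∈ B ∩ D n) : p (f n x) < b / 2 := by
    have hxU : p (P x + v n) < a / 2 := disjointed_subset U n hx.2
    have h1 : f n x = x + (t - 1) • (P x + v n) := by
      simp only [f, hTx]; module
    have h2 : p (f n x) ≤ p x + (t - 1) * p (P x + v n) := by
      rw [h1]
      refine (map_add_le_add p _ _).trans ?_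
      rw [map_smul_eq_mul, Real.norm_of_nonneg (by linarith)]
    have h3 := hBa x hx.1
    nlinarith
  have hkey (n m : ℕ) {x y : E} (hx : x ∈ B ∩ D n) (hy : y ∈ B ∩ D m)
      (h : f n x - f m y ∈ Γ) : n = m ∧ x = y := by
    -- A difference in `Γ` this short lies in `V`. Hence `x` and `y` share a fibre, where the
    -- stretching is a translation, and the packing property of `B` applies.
    have hlt : p (f n x - f m y) < b := by
      have := map_sub_le_add p (f n x) (f m y)
      linarith [hfp n hx, hfp m hy]
    have h0 := hP2 _ (hV _ h hlt)
    rw [map_sub, hPf, hPf, ← smul_sub, smul_eq_zero, sub_eq_zero] at h0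
    have hPxy : P x = P y := h0.resolve_left (by positivity)
    have hnm : n = m := by
      by_contra hne
      exact Set.disjoint_left.1 (disjoint_disjointed U hne) (hDP n hPxy hx.2) hy.2
    subst hnm
    refine ⟨rfl, hBΓ x hx.1 y hy.1 ?_⟩
    have : f n x - f n y = x - y := by
      simp only [f, hTx, hPxy]; module
    rwa [← this]
  have hfm (n : ℕ) : MeasurableSet (f n '' (B ∩ D n)) :=
    (hB.inter (hDm n)).image_of_continuousOn_injOn (hfc n).continuousOn (hfinj n).injOn
  refine ⟨⋃ n, f n '' (B ∩ D n), MeasurableSet.iUnion hfm, ?_, ?_, ?_⟩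
  · intro z hz
    obtain ⟨n, x, hx, rfl⟩ := Set.mem_iUnion.1 hz
    exact hfp n hx
  · intro z hz w hw h
    obtain ⟨n, x, hx, rfl⟩ := Set.mem_iUnion.1 hz
    obtain ⟨m, y, hy, rfl⟩ := Set.mem_iUnion.1 hw
    obtain ⟨rfl, rfl⟩ := hkey n m hx hy h
    rfl
  · have himg (n : ℕ) : μ (f n '' (B ∩ D n)) =
        ENNReal.ofReal (t ^ (finrank ℝ E - finrank ℝ V)) * μ (B ∩ D n) := by
      have : f n '' (B ∩ D n) = (fun z => z + (t - 1) • (v n : E)) '' (T '' (B ∩ D n)) := by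
        rw [Set.image_image]
      rw [this, Set.image_add_right, measure_preimage_add_right,
        Measure.addHaar_image_linearMap, hT, hdet, abs_of_nonneg (by positivity)]
    rw [measure_iUnion _ hfm]
    · simp_rw [himg]
      rw [ENNReal.tsum_mul_left, ← measure_iUnion _ (fun n => hB.inter (hDm n)),
        ← Set.inter_iUnion, Set.inter_eq_left.2 hcover]
      exact fun n m hnm => ((disjoint_disjointed U hnm).mono
        Set.inter_subset_right Set.inter_subset_right)
    · intro n m hnm
      refine Set.disjoint_left.2 ?_
      rintro _ ⟨x, hx, rfl⟩ ⟨y, hy, hxy⟩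
      exact hnm (hkey n m hx hy (by rw [hxy, sub_self]; exact Γ.zero_mem)).1

/-- **Minkowski's second theorem**, with the sharp constant, for the open unit ball of a continuous
seminorm. -/
theorem prod_mul_measure_ball_le_covolume (μ : Measure E) [μ.IsAddHaarMeasure] (p : Seminorm ℝ E)
    (hp : Continuous p) (Λ : Submodule ℤ E) [DiscreteTopology Λ] [IsZLattice ℝ Λ] {l : ℕ → ℝ}
    (hl0 : ∀ i < finrank ℝ E, 0 < l i)
    (hl : ∀ i, i + 1 < finrank ℝ E → l i ≤ l (i + 1))
    (hlΛ : ∀ i < finrank ℝ E, finrank ℝ (Submodule.span ℝ {x | x ∈ Λ ∧ p x < l i}) ≤ i)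
    (hE : 0 < finrank ℝ E) :
    ENNReal.ofReal (∏ i ∈ Finset.range (finrank ℝ E), l i) * μ (p.ball 0 (1 / 2)) ≤
      ENNReal.ofReal (ZLattice.covolume Λ μ) := by
  set d := finrank ℝ E with hd
  -- Stage `k + 1` stretches by `l (k + 1) / l k` in at least `d - (k + 1)` directions. At `k = d -
  -- 1` the bound is the full product.
  have key : ∀ k < d, ∃ B : Set E, MeasurableSet B ∧ (∀ x ∈ B, p x < l k / 2) ∧
      (∀ x ∈ B, ∀ y ∈ B, x - y ∈ Λ → x = y) ∧
      ENNReal.ofReal ((∏ i ∈ Finset.range k, l i) * l k ^ (d - k)) * μ (p.ball 0 (1 / 2)) ≤ μ B := by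
    intro k
    induction k with
    | zero =>
      intro h0
      have hl00 := hl0 0 h0
      refine ⟨p.ball 0 (l 0 / 2), ?_, fun x hx => by simpa [p.mem_ball] using hx, ?_, ?_⟩
      · have : p.ball 0 (l 0 / 2) = {x | p x < l 0 / 2} := by ext; simp [p.mem_ball]
        rw [this]
        exact (isOpen_lt hp continuous_const).measurableSet
      · intro x hx y hy h
        simp only [p.mem_ball, sub_zero] at hx hy
        have hlt : p (x - y) < l 0 := by linarith [map_sub_le_add p x y]
        have h1 := Submodule.finrank_eq_zero.1 (Nat.le_zero.1 (hlΛ 0 h0))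
        have h2 : x - y ∈ Submodule.span ℝ {x | x ∈ Λ ∧ p x < l 0} :=
          Submodule.subset_span ⟨h, hlt⟩
        rw [h1, Submodule.mem_bot, sub_eq_zero] at h2
        exact h2
      · have : p.ball 0 (l 0 / 2) = l 0 • p.ball 0 (1 / 2) := by
          rw [Seminorm.smul_ball_zero hl00.ne', Real.norm_of_nonneg hl00.le, mul_one_div]
        rw [this, Measure.addHaar_smul, abs_of_nonneg (by positivity)]
        simp [← hd]
    | succ k ih =>
      intro hk
      obtain ⟨B, hB, hBp, hBΛ, hBμ⟩ := ih (by omega)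
      have hk0 := hl0 k (by omega)
      obtain ⟨B', hB', hBp', hBΛ', hBμ'⟩ := exists_stretched_packing μ p hp Λ
        (Submodule.span ℝ {x | x ∈ Λ ∧ p x < l (k + 1)}) hk0 (hl k hk)
        (fun x hx hxp => Submodule.subset_span ⟨hx, hxp⟩) hB hBp hBΛ
      refine ⟨B', hB', hBp', hBΛ', ?_⟩
      have h1 : 1 ≤ l (k + 1) / l k := by rw [le_div_iff₀ hk0]; linarith [hl k hk]
      rw [hBμ']
      refine le_trans ?_ (mul_le_mul' (ENNReal.ofReal_le_ofReal
        (pow_le_pow_right₀ h1 (Nat.sub_le_sub_left (hlΛ (k + 1) hk) d))) hBμ)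
      rw [← mul_assoc, ← ENNReal.ofReal_mul (by positivity)]
      refine le_of_eq ?_
      congr 2
      have : d - k = (d - (k + 1)) + 1 := by omega
      rw [this, Finset.prod_range_succ, div_pow, pow_succ]
      field_simp
  obtain ⟨B, hB, -, hBΛ, hBμ⟩ := key (d - 1) (by omega)
  have hd1 : d - (d - 1) = 1 := by omega
  rw [hd1, pow_one, ← Finset.prod_range_succ, Nat.sub_add_cancel hE] at hBμ
  refine hBμ.trans ?_
  -- Blichfeldt's principle: a set larger than a fundamental domain has two points differing by a
  -- nonzero lattice vector.
  by_contra! hlt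
  have : MeasurableVAdd Λ E := (inferInstance : MeasurableVAdd Λ.toAddSubgroup E)
  have : VAddInvariantMeasure Λ E μ := (inferInstance : VAddInvariantMeasure Λ.toAddSubgroup E μ)
  have fund := ZLattice.isAddFundamentalDomain (Free.chooseBasis ℤ Λ) μ
  rw [ZLattice.covolume_eq_measure_fundamentalDomain Λ μ fund, ofReal_measureReal
    (ZSpan.fundamentalDomain_isBounded _).measure_lt_top.ne] at hlt
  obtain ⟨x, y, hxy, hnd⟩ :=
    exists_pair_mem_lattice_not_disjoint_vadd fund hB.nullMeasurableSet hlt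
  obtain ⟨_, ⟨u, hu, rfl⟩, ⟨w, hw, hwu⟩⟩ := Set.not_disjoint_iff.1 hnd
  have hwu' : (y : E) + w = x + u := hwu
  have hmem : u - w ∈ Λ := by
    have : u - w = y - x := by
      rw [sub_eq_sub_iff_add_eq_add, add_comm u, hwu']
    rw [this]
    exact Λ.sub_mem y.2 x.2
  have := hBΛ u hu w hw hmem
  subst this
  exact hxy (Subtype.ext (add_right_cancel hwu').symm)

end

variable {d : ℕ}

/-! ### The gauge of a box and its successive minima -/

/-- The gauge of `box τ`. -/
noncomputable def gaugeBox (τ : Fin d → ℝ) : Seminorm ℝ (Fin d → ℝ) :=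
  (normSeminorm ℝ (Fin d → ℝ)).comp
    (Matrix.toLin' (Matrix.diagonal fun i => Real.exp (-τ i)))

lemma gaugeBox_apply (τ x : Fin d → ℝ) :
    gaugeBox τ x = ‖fun i => Real.exp (-τ i) * x i‖ := by
  simp only [gaugeBox, Seminorm.comp_apply, coe_normSeminorm, Matrix.toLin'_apply]
  congr 1
  ext i
  simp [Matrix.mulVec_diagonal]

lemma gaugeBox_le_iff (τ x : Fin d → ℝ) {r : ℝ} (hr : 0 ≤ r) :
    gaugeBox τ x ≤ r ↔ ∀ i, |x i| ≤ r * Real.exp (τ i) := by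
  rw [gaugeBox_apply, pi_norm_le_iff_of_nonneg hr]
  refine forall_congr' fun i => ?_
  rw [Real.norm_eq_abs, abs_mul, abs_of_pos (Real.exp_pos _), Real.exp_neg, inv_mul_le_iff₀
    (Real.exp_pos _), mul_comm]

lemma gaugeBox_lt_iff (τ x : Fin d → ℝ) {r : ℝ} (hr : 0 < r) :
    gaugeBox τ x < r ↔ ∀ i, |x i| < r * Real.exp (τ i) := by
  rw [gaugeBox_apply, pi_norm_lt_iff hr]
  refine forall_congr' fun i => ?_
  rw [Real.norm_eq_abs, abs_mul, abs_of_pos (Real.exp_pos _), Real.exp_neg, inv_mul_lt_iff₀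
    (Real.exp_pos _), mul_comm]

lemma abs_le_gaugeBox (τ x : Fin d → ℝ) (i : Fin d) : |x i| ≤ gaugeBox τ x * Real.exp (τ i) :=
  (gaugeBox_le_iff τ x (apply_nonneg _ _)).1 le_rfl i

lemma continuous_gaugeBox (τ : Fin d → ℝ) : Continuous (gaugeBox τ) := by
  have : (gaugeBox τ : (Fin d → ℝ) → ℝ) = fun x => ‖fun i => Real.exp (-τ i) * x i‖ :=
    funext (gaugeBox_apply τ)
  rw [this]
  fun_prop

lemma gaugeBox_pos (τ : Fin d → ℝ) {x : Fin d → ℝ} (hx : x ≠ 0) : 0 < gaugeBox τ x := by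
  refine (apply_nonneg _ _).lt_of_ne' fun h => hx ?_
  ext i
  have := abs_le_gaugeBox τ x i
  rw [h, zero_mul] at this
  exact abs_nonpos_iff.1 this

lemma mem_box_iff (τ x : Fin d → ℝ) : x ∈ box τ ↔ gaugeBox τ x ≤ 1 := by
  rw [gaugeBox_apply, box]
  constructor
  · rintro ⟨y, hy, rfl⟩
    rw [mem_closedBall_zero_iff] at hy
    have : (fun i => Real.exp (-τ i) *
        (Matrix.diagonal fun i => Real.exp (τ i)).mulVec y i) = y := by
      ext i
      rw [Matrix.mulVec_diagonal, ← mul_assoc, ← Real.exp_add]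
      simp
    rwa [this]
  · intro h
    refine ⟨_, mem_closedBall_zero_iff.2 h, ?_⟩
    ext i
    rw [Matrix.mulVec_diagonal, ← mul_assoc, ← Real.exp_add]
    simp

lemma mem_smul_box_iff (τ x : Fin d → ℝ) {r : ℝ} (hr : 0 < r) :
    x ∈ r • box τ ↔ gaugeBox τ x ≤ r := by
  rw [Set.mem_smul_set_iff_inv_smul_mem₀ hr.ne', mem_box_iff, map_smul_eq_mul, norm_inv,
    Real.norm_of_nonneg hr.le, inv_mul_le_iff₀ hr, mul_one]

lemma volume_gaugeBox_ball (τ : Fin d → ℝ) (hτ : ∑ i, τ i = 0) :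
    volume ((gaugeBox τ).ball 0 (1 / 2)) = 1 := by
  have : (gaugeBox τ).ball 0 (1 / 2) =
      Set.pi Set.univ fun i => Set.Ioo (-(1 / 2 * Real.exp (τ i))) (1 / 2 * Real.exp (τ i)) := by
    ext x
    rw [Seminorm.mem_ball, sub_zero, gaugeBox_lt_iff _ _ (by norm_num)]
    simp [abs_lt]
  rw [this, Real.volume_pi_Ioo, ← ENNReal.ofReal_prod_of_nonneg]
  · have h (i : Fin d) : 1 / 2 * Real.exp (τ i) - -(1 / 2 * Real.exp (τ i)) = Real.exp (τ i) := by
      ring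
    simp_rw [h]
    rw [← Real.exp_sum, hτ]
    simp
  · intro i _
    have := Real.exp_pos (τ i)
    linarith

/-- The dilation factors over which `successiveMinimum (box τ) Λ k` is the infimum. -/
def admissible (τ : Fin d → ℝ) (Λ : Submodule ℤ (Fin d → ℝ)) (k : ℕ) : Set ℝ :=
  {r : ℝ | 0 < r ∧ ∃ v : Fin k → (Fin d → ℝ),
    LinearIndependent ℝ v ∧ ∀ i, v i ∈ Λ ∧ gaugeBox τ (v i) ≤ r}

lemma successiveMinimum_box (τ : Fin d → ℝ) (Λ : Submodule ℤ (Fin d → ℝ)) (k : ℕ) :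
    successiveMinimum (box τ) Λ k = sInf (admissible τ Λ k) := by
  rw [successiveMinimum, admissible]
  congr 1
  ext r
  refine and_congr_right fun hr => ?_
  simp_rw [mem_smul_box_iff τ _ hr]

lemma bddBelow_admissible (τ : Fin d → ℝ) (Λ : Submodule ℤ (Fin d → ℝ)) (k : ℕ) :
    BddBelow (admissible τ Λ k) := ⟨0, fun _ hr => hr.1.le⟩

lemma admissible_anti (τ : Fin d → ℝ) (Λ : Submodule ℤ (Fin d → ℝ)) {j k : ℕ} (hjk : j ≤ k) :
    admissible τ Λ k ⊆ admissible τ Λ j := by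
  rintro r ⟨hr, v, hv, hvr⟩
  exact ⟨hr, v ∘ Fin.castLE hjk, hv.comp _ (Fin.castLE_injective hjk), fun i => hvr _⟩

/-- A spanning family is finite, so its largest gauge is still strictly below `s`; no attainment of
the infimum is needed. -/
lemma mem_admissible_of_lt_finrank (τ : Fin d → ℝ) (Λ : Submodule ℤ (Fin d → ℝ)) {s : ℝ} {k : ℕ}
    (hs : 0 < s) (hk : k ≤ finrank ℝ (Submodule.span ℝ {x | x ∈ Λ ∧ gaugeBox τ x < s})) :
    ∃ r ∈ admissible τ Λ k, r < s := by
  obtain ⟨f, hf, -, hfli⟩ := Submodule.exists_fun_fin_finrank_span_eq ℝ {x | x ∈ Λ ∧ gaugeBox τ x < s}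
  generalize finrank ℝ (Submodule.span ℝ {x | x ∈ Λ ∧ gaugeBox τ x < s}) = n at *
  obtain ⟨r, hr0, hrs, hr⟩ : ∃ r, 0 < r ∧ r < s ∧ ∀ i, gaugeBox τ (f i) ≤ r := by
    rcases isEmpty_or_nonempty (Fin n) with h | h
    · exact ⟨s / 2, by linarith, by linarith, fun i => isEmptyElim i⟩
    · obtain ⟨i, -, hi⟩ := Finset.exists_max_image Finset.univ (fun i => gaugeBox τ (f i))
        Finset.univ_nonempty
      exact ⟨_, gaugeBox_pos τ (hfli.ne_zero i), (hf i).2, fun j => hi j (Finset.mem_univ _)⟩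
  exact ⟨r, admissible_anti τ Λ hk ⟨hr0, f, hfli, fun i => ⟨(hf i).1, hr i⟩⟩, hrs⟩

lemma finrank_span_lt_successiveMinimum_le (τ : Fin d → ℝ) (Λ : Submodule ℤ (Fin d → ℝ)) (k : ℕ)
    (hpos : 0 < successiveMinimum (box τ) Λ (k + 1)) :
    finrank ℝ (Submodule.span ℝ
      {x | x ∈ Λ ∧ gaugeBox τ x < successiveMinimum (box τ) Λ (k + 1)}) ≤ k := by
  by_contra! h
  obtain ⟨r, hr, hrs⟩ := mem_admissible_of_lt_finrank τ Λ hpos h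
  rw [successiveMinimum_box] at hrs
  exact hrs.not_ge (csInf_le (bddBelow_admissible τ Λ _) hr)

/-! ### Successive minima of a lattice and the sums `S` -/

section

variable (Λ : Submodule ℤ (Fin d → ℝ))

lemma admissible_nonempty [DiscreteTopology Λ] [IsZLattice ℝ Λ] (τ : Fin d → ℝ) {k : ℕ}
    (hk : k ≤ d) : (admissible τ Λ k).Nonempty := by
  let b : Basis (Fin d) ℤ Λ := IsZLattice.basis Λ
  have hb : LinearIndependent ℝ (b.ofZLatticeBasis ℝ Λ) := Basis.linearIndependent _
  obtain ⟨r, hr⟩ := (Set.finite_range fun i => gaugeBox τ (b.ofZLatticeBasis ℝ Λ i)).bddAbove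
  -- The `max` with `1` keeps the factor positive even for `d = 0`.
  refine ⟨max r 1, admissible_anti τ Λ hk ⟨by positivity, _, hb, fun i => ⟨?_, ?_⟩⟩⟩
  · rw [Basis.ofZLatticeBasis_apply]
    exact (b i).2
  · exact (hr (Set.mem_range_self i)).trans (le_max_left _ _)

lemma exists_pos_le_gaugeBox [DiscreteTopology Λ] (τ : Fin d → ℝ) :
    ∃ ε > 0, ∀ x ∈ Λ, x ≠ 0 → ε ≤ gaugeBox τ x := by
  obtain ⟨U, hU, hU0⟩ := isOpen_induced_iff.1 (isOpen_discrete ({0} : Set Λ))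
  have h0 : (0 : Fin d → ℝ) ∈ U := by
    have : (0 : Λ) ∈ (Subtype.val ⁻¹' U : Set Λ) := by rw [hU0]; rfl
    exact this
  obtain ⟨δ, hδ, hδU⟩ := Metric.isOpen_iff.1 hU 0 h0
  obtain ⟨M, hM⟩ := (Set.finite_range fun i => Real.exp (τ i)).bddAbove
  refine ⟨δ / (2 * max M 1), by positivity, fun x hx hx0 => ?_⟩
  by_contra! hlt
  refine hx0 ?_
  have hxU : x ∈ U := by
    refine hδU ?_
    rw [mem_ball_zero_iff, pi_norm_lt_iff hδ]
    intro i
    calc ‖x i‖ ≤ gaugeBox τ x * Real.exp (τ i) := abs_le_gaugeBox τ x i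
      _ ≤ δ / (2 * max M 1) * max M 1 :=
          mul_le_mul hlt.le ((hM (Set.mem_range_self i)).trans (le_max_left _ _))
            (Real.exp_pos _).le (by positivity)
      _ = δ / 2 := by
          have : (0 : ℝ) < max M 1 := by positivity
          field_simp
      _ < δ := by linarith
  have : (⟨x, hx⟩ : Λ) ∈ ({0} : Set Λ) := by rw [← hU0]; exact hxU
  exact congrArg Subtype.val (Set.mem_singleton_iff.1 this)

lemma S_eq_sum_range (τ : Fin d → ℝ) (k : ℕ) : S k τ Λ = ∑ i ∈ Finset.range k, L (i + 1) τ Λ := by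
  rw [S, Finset.range_eq_Ico, Finset.sum_Ico_add' (fun j => L j τ Λ) 0 k 1]
  rfl

lemma S_succ (τ : Fin d → ℝ) (k : ℕ) : S (k + 1) τ Λ = S k τ Λ + L (k + 1) τ Λ := by
  rw [S_eq_sum_range, S_eq_sum_range, Finset.sum_range_succ]

lemma S_eq_add_sum_Ico (τ : Fin d → ℝ) {k : ℕ} (hk : k ≤ d) :
    S d τ Λ = S k τ Λ + ∑ i ∈ Finset.Ico k d, L (i + 1) τ Λ := by
  rw [S_eq_sum_range, S_eq_sum_range, Finset.sum_range_add_sum_Ico _ hk]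

section

variable [DiscreteTopology Λ] [IsZLattice ℝ Λ] (τ : Fin d → ℝ)

lemma successiveMinimum_pos {k : ℕ} (hk1 : 1 ≤ k) (hk : k ≤ d) :
    0 < successiveMinimum (box τ) Λ k := by
  obtain ⟨ε, hε, h⟩ := exists_pos_le_gaugeBox Λ τ
  rw [successiveMinimum_box]
  refine hε.trans_le (le_csInf (admissible_nonempty Λ τ hk) ?_)
  rintro r ⟨-, v, hv, hvr⟩
  exact (h _ (hvr ⟨0, hk1⟩).1 (hv.ne_zero _)).trans (hvr ⟨0, hk1⟩).2

lemma successiveMinimum_mono {j k : ℕ} (hjk : j ≤ k) (hk : k ≤ d) :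
    successiveMinimum (box τ) Λ j ≤ successiveMinimum (box τ) Λ k := by
  rw [successiveMinimum_box, successiveMinimum_box]
  exact csInf_le_csInf (bddBelow_admissible τ Λ j) (admissible_nonempty Λ τ hk)
    (admissible_anti τ Λ hjk)

lemma L_mono {j k : ℕ} (hj : 1 ≤ j) (hjk : j ≤ k) (hk : k ≤ d) : L j τ Λ ≤ L k τ Λ :=
  Real.log_le_log (successiveMinimum_pos Λ τ hj (hjk.trans hk)) (successiveMinimum_mono Λ τ hjk hk)

/-- Minkowski's second theorem for the box `box τ` and a unimodular lattice. -/
lemma S_top_nonpos (hΛ : ZLattice.covolume Λ = 1) (hτ : ∑ i, τ i = 0) : S d τ Λ ≤ 0 := by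
  rcases Nat.eq_zero_or_pos d with rfl | hd
  · simp [S]
  have hfin : finrank ℝ (Fin d → ℝ) = d := by simp
  have h := prod_mul_measure_ball_le_covolume volume (gaugeBox τ) (continuous_gaugeBox τ) Λ
    (l := fun i => successiveMinimum (box τ) Λ (i + 1))
    (fun i hi => successiveMinimum_pos Λ τ (by omega) (by omega))
    (fun i hi => successiveMinimum_mono Λ τ (by omega) (by omega))
    (fun i hi => finrank_span_lt_successiveMinimum_le τ Λ i
      (successiveMinimum_pos Λ τ (by omega) (by omega)))
    (by omega)
  rw [volume_gaugeBox_ball τ hτ, mul_one, hΛ, ENNReal.ofReal_le_ofReal_iff zero_le_one, hfin] at h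
  have hpos : ∀ i ∈ Finset.range d, 0 < successiveMinimum (box τ) Λ (i + 1) := fun i hi =>
    successiveMinimum_pos Λ τ (by omega) (by have := Finset.mem_range.1 hi; omega)
  have hlog := Real.log_nonpos (Finset.prod_nonneg fun i hi => (hpos i hi).le) h
  rw [Real.log_prod fun i hi => (hpos i hi).ne'] at hlog
  rwa [S_eq_sum_range]

lemma S_le_mul_L {k : ℕ} (hk : k + 1 ≤ d) : S k τ Λ ≤ k * L (k + 1) τ Λ := by
  rw [S_eq_sum_range]
  have := Finset.sum_le_card_nsmul (Finset.range k) (fun i => L (i + 1) τ Λ) (L (k + 1) τ Λ)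
    fun i hi => L_mono Λ τ (by omega) (by have := Finset.mem_range.1 hi; omega) hk
  simpa using this

lemma S_add_mul_L_le {k : ℕ} (hk : k ≤ d) :
    S k τ Λ + ((d : ℝ) - k) * L (k + 1) τ Λ ≤ S d τ Λ := by
  rw [S_eq_add_sum_Ico Λ τ hk]
  have := Finset.card_nsmul_le_sum (Finset.Ico k d) (fun i => L (i + 1) τ Λ) (L (k + 1) τ Λ)
    fun i hi => by
      have := Finset.mem_Ico.1 hi
      exact L_mono Λ τ (by omega) (by omega) (by omega)
  rw [Nat.card_Ico, nsmul_eq_mul, Nat.cast_sub hk] at this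
  linarith

end

end

/-! ### The dual lattice and duality of successive minima -/

lemma mem_dualLattice_iff (Λ : Submodule ℤ (Fin d → ℝ)) (y : Fin d → ℝ) :
    y ∈ dualLattice Λ ↔ ∀ x ∈ Λ, ∃ n : ℤ, (n : ℝ) = y ⬝ᵥ x := by
  rw [dualLattice, LinearMap.BilinForm.mem_dualSubmodule]
  simp [Submodule.mem_one]

lemma dotProductBilin_nondegenerate :
    LinearMap.BilinForm.Nondegenerate
      (dotProductBilin ℝ ℝ : LinearMap.BilinForm ℝ (Fin d → ℝ)) := by
  refine ⟨fun x hx => dotProduct_eq_zero x hx, fun x hx => dotProduct_eq_zero x fun y => ?_⟩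
  rw [dotProduct_comm]
  exact hx y

lemma covolume_span_basis (c : Basis (Fin d) ℝ (Fin d → ℝ)) :
    ZLattice.covolume (Submodule.span ℤ (Set.range c)) = |(Matrix.of c).det| := by
  rw [ZLattice.covolume_eq_measure_fundamentalDomain _ volume
    (ZSpan.isAddFundamentalDomain c volume), ZSpan.volume_real_fundamentalDomain]

/-- The dual of a lattice is a lattice, with the inverse covolume. -/
lemma dualLattice_isZLattice_and_covolume (Λ : Submodule ℤ (Fin d → ℝ)) [DiscreteTopology Λ]
    [IsZLattice ℝ Λ] :
    DiscreteTopology (dualLattice Λ) ∧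
      (∀ _ : DiscreteTopology (dualLattice Λ), IsZLattice ℝ (dualLattice Λ)) ∧
      ZLattice.covolume Λ * ZLattice.covolume (dualLattice Λ) = 1 := by
  let b : Basis (Fin d) ℝ (Fin d → ℝ) := (IsZLattice.basis Λ).ofZLatticeBasis ℝ Λ
  have hb : Submodule.span ℤ (Set.range b) = Λ := Basis.ofZLatticeBasis_span ℝ Λ _
  let c := LinearMap.BilinForm.dualBasis _ (dotProductBilin_nondegenerate (d := d)) b
  have hc : dualLattice Λ = Submodule.span ℤ (Set.range c) := by
    rw [dualLattice, ← hb]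
    exact LinearMap.BilinForm.dualSubmodule_span_of_basis _ dotProductBilin_nondegenerate b
  refine ⟨by rw [hc]; infer_instance, by rw [hc]; intro _; infer_instance, ?_⟩
  have hcov : ZLattice.covolume Λ = |(Matrix.of b).det| := by
    rw [← covolume_span_basis, hb]
  rw [hc, covolume_span_basis, hcov, ← abs_mul, mul_comm, ← Matrix.det_transpose (Matrix.of b),
    ← Matrix.det_mul]
  have : Matrix.of c * (Matrix.of b).transpose = 1 := by
    ext i j
    have h := LinearMap.BilinForm.apply_dualBasis_left
      (B := (dotProductBilin ℝ ℝ : LinearMap.BilinForm ℝ (Fin d → ℝ)))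
      dotProductBilin_nondegenerate b i j
    rw [Matrix.one_apply]
    simp only [eq_comm (a := i)]
    rw [← h]
    rfl
  rw [this]
  simp

/-- Otherwise the span of `w` lies in the orthogonal complement of the span of `u`, forcing `k ≤ d -
j`. -/
lemma exists_dotProduct_ne_zero {j k : ℕ} (hjk : d < j + k) {u : Fin j → Fin d → ℝ}
    {w : Fin k → Fin d → ℝ} (hu : LinearIndependent ℝ u) (hw : LinearIndependent ℝ w) :
    ∃ a b, w b ⬝ᵥ u a ≠ 0 := by
  by_contra! h
  have hrank := LinearIndependent.rank_matrix (M := Matrix.of u) hu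
  have hker := LinearMap.finrank_range_add_finrank_ker (Matrix.of u).mulVecLin
  have hle : Submodule.span ℝ (Set.range w) ≤ LinearMap.ker (Matrix.of u).mulVecLin := by
    rw [Submodule.span_le]
    rintro _ ⟨b, rfl⟩
    ext a
    simpa [Matrix.mulVec, dotProduct_comm] using h a b
  have h1 := Submodule.finrank_mono hle
  rw [finrank_span_eq_card hw] at h1
  rw [Matrix.rank] at hrank
  simp only [Fintype.card_fin, finrank_fintype_fun_eq_card] at *
  omega

lemma abs_dotProduct_le (τ x y : Fin d → ℝ) :
    |y ⬝ᵥ x| ≤ d * (gaugeBox τ x * gaugeBox (-τ) y) := by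
  refine (Finset.abs_sum_le_sum_abs _ _).trans ?_
  refine (Finset.sum_le_card_nsmul _ _ (gaugeBox τ x * gaugeBox (-τ) y) fun i _ => ?_).trans
    (by simp)
  rw [abs_mul]
  calc |y i| * |x i|
      ≤ (gaugeBox (-τ) y * Real.exp ((-τ) i)) * (gaugeBox τ x * Real.exp (τ i)) :=
        mul_le_mul (abs_le_gaugeBox _ _ _) (abs_le_gaugeBox _ _ _) (abs_nonneg _)
          (mul_nonneg (apply_nonneg _ _) (Real.exp_pos _).le)
    _ = gaugeBox τ x * gaugeBox (-τ) y * (Real.exp ((-τ) i) * Real.exp (τ i)) := by ring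
    _ = gaugeBox τ x * gaugeBox (-τ) y := by
        rw [← Real.exp_add]; simp

lemma one_le_mul_of_mem_admissible (Λ : Submodule ℤ (Fin d → ℝ)) (τ : Fin d → ℝ) {j k : ℕ}
    (hjk : d < j + k) {r s : ℝ} (hr : r ∈ admissible τ Λ j)
    (hs : s ∈ admissible (-τ) (dualLattice Λ) k) : 1 ≤ d * (r * s) := by
  obtain ⟨hr0, u, hu, hur⟩ := hr
  obtain ⟨hs0, w, hw, hws⟩ := hs
  obtain ⟨a, b, hab⟩ := exists_dotProduct_ne_zero hjk hu hw
  obtain ⟨n, hn⟩ := (mem_dualLattice_iff Λ _).1 (hws b).1 _ (hur a).1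
  have h1 : (1 : ℝ) ≤ |w b ⬝ᵥ u a| := by
    rw [← hn] at hab ⊢
    exact_mod_cast Int.one_le_abs (by exact_mod_cast hab)
  refine h1.trans ((abs_dotProduct_le τ _ _).trans ?_)
  gcongr
  · exact (hur a).2
  · exact (hws b).2

/-- The easy half of Mahler's duality for successive minima. -/
lemma one_le_mul_successiveMinimum (Λ : Submodule ℤ (Fin d → ℝ)) [DiscreteTopology Λ]
    [IsZLattice ℝ Λ] [DiscreteTopology (dualLattice Λ)] [IsZLattice ℝ (dualLattice Λ)]
    (τ : Fin d → ℝ) {j k : ℕ} (hj : j ≤ d) (hk : k ≤ d) (hjk : d < j + k) :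
    1 ≤ d * (successiveMinimum (box τ) Λ j *
      successiveMinimum (box (-τ)) (dualLattice Λ) k) := by
  have hd : (0 : ℝ) < d := by exact_mod_cast (by omega : 0 < d)
  have hpos := successiveMinimum_pos Λ τ (k := j) (by omega) hj
  -- The infima are taken one at a time, first over `r`, then over `s`.
  have h1 : ∀ s ∈ admissible (-τ) (dualLattice Λ) k,
      1 / (d * s) ≤ successiveMinimum (box τ) Λ j := by
    intro s hs
    rw [successiveMinimum_box]
    refine le_csInf (admissible_nonempty Λ τ hj) fun r hr => ?_
    have := one_le_mul_of_mem_admissible Λ τ hjk hr hs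
    have hs0 := hs.1
    rw [div_le_iff₀ (by positivity)]
    linarith
  have h2 : 1 / (d * successiveMinimum (box τ) Λ j) ≤
      successiveMinimum (box (-τ)) (dualLattice Λ) k := by
    rw [successiveMinimum_box (-τ)]
    refine le_csInf (admissible_nonempty _ _ hk) fun s hs => ?_
    have h := h1 s hs
    have hs0 := hs.1
    rw [div_le_iff₀ (by positivity)] at h ⊢
    linarith
  rw [div_le_iff₀ (by positivity)] at h2
  linarith

lemma neg_log_le_L_add_L (Λ : Submodule ℤ (Fin d → ℝ)) [DiscreteTopology Λ] [IsZLattice ℝ Λ]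
    [DiscreteTopology (dualLattice Λ)] [IsZLattice ℝ (dualLattice Λ)] (τ : Fin d → ℝ)
    {i : ℕ} (hi : i < d) :
    -Real.log d ≤ L (i + 1) τ Λ + L (d - 1 - i + 1) (-τ) (dualLattice Λ) := by
  have hd : (0 : ℝ) < d := by exact_mod_cast (by omega : 0 < d)
  have h1 := successiveMinimum_pos Λ τ (k := i + 1) (by omega) (by omega)
  have h2 := successiveMinimum_pos (dualLattice Λ) (-τ) (k := d - 1 - i + 1) (by omega) (by omega)
  have h := Real.log_nonneg (one_le_mul_successiveMinimum Λ τ (j := i + 1)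
    (k := d - 1 - i + 1) (by omega) (by omega) (by omega))
  rw [Real.log_mul hd.ne' (by positivity), Real.log_mul h1.ne' h2.ne'] at h
  rw [L, L]
  linarith

lemma sum_L_add_L (Λ : Submodule ℤ (Fin d → ℝ)) (τ : Fin d → ℝ) :
    ∑ i ∈ Finset.range d, (L (i + 1) τ Λ + L (d - 1 - i + 1) (-τ) (dualLattice Λ)) =
      S d τ Λ + S d (-τ) (dualLattice Λ) := by
  rw [Finset.sum_add_distrib, S_eq_sum_range, S_eq_sum_range,
    Finset.sum_range_reflect (fun i => L (i + 1) (-τ) (dualLattice Λ))]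

lemma S_dual_eq (Λ : Submodule ℤ (Fin d → ℝ)) (τ : Fin d → ℝ) (k : ℕ) :
    S (d - k) (-τ) (dualLattice Λ) =
      ∑ i ∈ Finset.Ico k d, L (d - 1 - i + 1) (-τ) (dualLattice Λ) := by
  rw [S_eq_sum_range, ← Finset.sum_range_reflect, Finset.sum_Ico_eq_sum_range]
  refine Finset.sum_congr rfl fun i hi => ?_
  congr 1
  omega

/-- The difference equals `S_d` minus the pair sums over `Ico k d`. Both terms are at most `d log d`
in absolute value: `S_d ≥ S_d + S*_d ≥ -d log d`, and the pair sums over `range k` bound those over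
`Ico k d` from above. -/
lemma abs_S_sub_S_dual_le (Λ : Submodule ℤ (Fin d → ℝ)) [DiscreteTopology Λ] [IsZLattice ℝ Λ]
    (hΛ : ZLattice.covolume Λ = 1) (τ : Fin d → ℝ) (hτ : ∑ i, τ i = 0) {k : ℕ} (hk : k ≤ d) :
    |S k τ Λ - S (d - k) (-τ) (dualLattice Λ)| ≤ 2 * d * Real.log d := by
  obtain ⟨h1, h2, h3⟩ := dualLattice_isZLattice_and_covolume Λ
  have := h2 h1
  rw [hΛ, one_mul] at h3
  have hS := S_top_nonpos Λ τ hΛ hτ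
  have hS' := S_top_nonpos (dualLattice Λ) (-τ) h3 (by simp [hτ])
  set a : ℕ → ℝ := fun i => L (i + 1) τ Λ + L (d - 1 - i + 1) (-τ) (dualLattice Λ) with ha
  have hlog : 0 ≤ Real.log d := Real.log_natCast_nonneg d
  have hlow : ∀ s ⊆ Finset.range d, -(d * Real.log d) ≤ ∑ i ∈ s, a i := by
    intro s hs
    have h := Finset.card_nsmul_le_sum s a (-Real.log d) fun i hi =>
      neg_log_le_L_add_L Λ τ (Finset.mem_range.1 (hs hi))
    have hcard : (s.card : ℝ) ≤ d := by
      exact_mod_cast (Finset.card_le_card hs).trans (Finset.card_range d).le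
    rw [nsmul_eq_mul] at h
    nlinarith
  have htot : ∑ i ∈ Finset.range d, a i = S d τ Λ + S d (-τ) (dualLattice Λ) := sum_L_add_L Λ τ
  have hsplit := Finset.sum_range_add_sum_Ico a hk
  have hIco : ∑ i ∈ Finset.Ico k d, a i =
      (S d τ Λ - S k τ Λ) + S (d - k) (-τ) (dualLattice Λ) := by
    rw [ha, Finset.sum_add_distrib, ← S_dual_eq Λ τ k, S_eq_add_sum_Ico Λ τ hk]
    ring
  have hl1 := hlow (Finset.Ico k d) fun i hi => Finset.mem_range.2 (Finset.mem_Ico.1 hi).2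
  have hl2 := hlow (Finset.range k) (Finset.range_subset_range.2 hk)
  have hl3 := hlow _ subset_rfl
  rw [abs_le]
  constructor <;> linarith

end MultParamGeom

theorem theoremt (d : ℕ) :
    -- (i), with a constant that depends on the dimension only
    (∃ C : ℝ, ∀ (Λ : Submodule ℤ (Fin d → ℝ)) [DiscreteTopology Λ] [IsZLattice ℝ Λ],
      ZLattice.covolume Λ = 1 → ∀ τ : Fin d → ℝ, ∑ i, τ i = 0 →
        ∀ k : ℕ, 1 ≤ k → k < d →
          |MultParamGeom.S k τ Λ -
            MultParamGeom.S (d - k) (-τ) (MultParamGeom.dualLattice Λ)| ≤ C) ∧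
    (∀ (Λ : Submodule ℤ (Fin d → ℝ)) [DiscreteTopology Λ] [IsZLattice ℝ Λ],
      ZLattice.covolume Λ = 1 → ∀ τ : Fin d → ℝ, ∑ i, τ i = 0 →
        -- (ii)
        (∀ k : ℕ, 1 ≤ k → k + 1 < d →
          MultParamGeom.S k τ Λ / (k : ℝ) ≤ MultParamGeom.S (k + 1) τ Λ / ((k : ℝ) + 1)) ∧
        -- (iii)
        (∀ k : ℕ, 1 ≤ k → k + 1 < d →
          MultParamGeom.S k τ Λ / ((d : ℝ) - (k : ℝ)) ≥
            MultParamGeom.S (k + 1) τ Λ / ((d : ℝ) - ((k : ℝ) + 1)))) := by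
  refine ⟨⟨2 * d * Real.log d, fun Λ _ _ hΛ τ hτ k _ hk =>
    MultParamGeom.abs_S_sub_S_dual_le Λ hΛ τ hτ hk.le⟩, fun Λ _ _ hΛ τ hτ =>
    ⟨fun k hk hkd => ?_, fun k hk hkd => ?_⟩⟩
  · have hk0 : (0 : ℝ) < k := by exact_mod_cast hk
    have h := MultParamGeom.S_le_mul_L Λ τ (k := k) hkd.le
    -- Cross-multiplied, the claim is exactly `S_k ≤ k L_{k+1}`.
    rw [div_le_div_iff₀ hk0 (by positivity), MultParamGeom.S_succ]
    linarith
  · have hkd' : (k : ℝ) + 1 < d := by exact_mod_cast hkd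
    have h := (MultParamGeom.S_add_mul_L_le Λ τ (k := k) (by omega)).trans
      (MultParamGeom.S_top_nonpos Λ τ hΛ hτ)
    -- Cross-multiplied, the claim is exactly `S_k + (d - k) L_{k+1} ≤ 0`.
    rw [ge_iff_le, div_le_div_iff₀ (by linarith) (by linarith), MultParamGeom.S_succ]
    linarith
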